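/- Let $p$ be a prime, $\mathbb{F}_q$ a finite field of characteristic $p$, $\mathbb{Z}_q=W(\mathbb{F}_q)$ the ring of integers of the unramified extension of $\mathbb{Q}_p$ with residue field $\mathbb{F}_q$, and $\sigma:\mathbb{Z}_q\to\mathbb{Z}_q$ the lift of the $p$-th power Frobenius of $\mathbb{F}_q$; write $f^\sigma$ for the polynomial obtained by applying $\sigma$ to the coefficients of $f$. Let $Q\in\mathbb{F}_q[x,y]$ be irreducible, monic in $y$, and separable as a polynomial in $y$ over $\mathbb{F}_q(x)$. Let $\mathcal{Q}\in\mathbb{Z}_q[x,y]$ be a lift of $Q$ that is monic in $y$ and has the same monomials in its support as $Q$. Let $\Delta\in\mathbb{Z}_q[x]$ be the discriminant of $\mathcal{Q}$ with respect to $y$ and let $r=\Delta/\gcd(\Delta,\frac{d\Delta}{dx})$. Let $\mathbb{Z}_q\langle x,z,y\rangle^{\dagger}$ be the ring of overconvergent power series, i.e. of those $\sum_I a_I\,(x,z,y)^I$ with $a_I\in\mathbb{Z}_q$ for which there are $\varepsilon>0$ and $C$ with $\mathrm{ord}_p(a_I)\ge \varepsilon|I|-C$ for all $I$, and put $$\mathcal{R}^{\dagger}=\mathbb{Z}_q\langle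 x,1/r,y\rangle^{\dagger}/(\mathcal{Q})=\mathbb{Z}_q\langle x,z,y\rangle^{\dagger}/\bigl(z\,r(x)-1,\ \mathcal{Q}(x,y)\bigr),$$ where $1/r$ is the class of $z$. Then there exists a Frobenius lift $\mathrm{Frob}_p:\mathcal{R}^{\dagger}\to\mathcal{R}^{\dagger}$, i.e. a $\sigma$-semilinear ring homomorphism that reduces modulo $p$ to the $p$-th power map, with $\mathrm{Frob}_p(x)=x^p$, and with the following property. Let $s\in\mathbb{Z}_q[x,y]$ be any polynomial with $s\,\frac{\partial\mathcal{Q}}{\partial y}\equiv r \pmod{\mathcal{Q}}$, and let $(\alpha_i)_{i\ge0},(\beta_i)_{i\ge 0}$ be any sequences in $\mathcal{R}^{\dagger}$ with $\alpha_0=1/r^p$, $\beta_0=y^p$ and, for all $i\ge 0$, $$\alpha_{i+1}\equiv\alpha_i\bigl(2-\alpha_i r^{\sigma}(x^p)\bigr),\qquad \beta_{i+1}\equiv\beta_i-\mathcal{Q}^{\sigma}(x^p,\beta_i)\,s^{\sigma}(x^p,\beta_i)\,\alpha_i \pmod{p^{2^{i+1}}}.$$ Then $\mathrm{Frob}_p(1/r)\equiv\alpha_i$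 and $\mathrm{Frob}_p(y)\equiv\beta_i \pmod{p^{2^i}}$ for all $i\ge 0$. -/

import Mathlib

open Polynomial
open scoped Polynomial.Bivariate

noncomputable section

namespace FrobLift

/-- A power series `f = ∑ a_I x^I` over `A` is (`p`-adically) overconvergent if, for some constant
`c`, every `a_I` with `|I| > c * m` is divisible by `p ^ m` (`m ≥ 1`).  Equivalently, the terms
whose coefficient has valuation `j` have total degree at most `c * (j + 1)`: this is the
Monsky–Washnitzer growth condition `ord_p (a_I) ≥ ε |I| - C` for some `ε > 0` and `C`, that is,
convergence on a polydisc of radius greater than `1`. -/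
def IsOverconvergent (p : ℕ) {A ι : Type*} [CommRing A] (f : MvPowerSeries ι A) : Prop :=
  ∃ c : ℕ, ∀ (I : ι →₀ ℕ) (m : ℕ), c * m < I.degree → (p : A) ^ m ∣ MvPowerSeries.coeff I f

section closure

variable {p : ℕ} {A ι : Type*} [CommRing A]

theorem IsOverconvergent.add {f g : MvPowerSeries ι A} (hf : IsOverconvergent p f)
    (hg : IsOverconvergent p g) : IsOverconvergent p (f + g) := by
  obtain ⟨c, hc⟩ := hf
  obtain ⟨d, hd⟩ := hg
  refine ⟨c + d, fun I m h => ?_⟩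
  rw [map_add]
  exact dvd_add (hc I m (by nlinarith [Nat.zero_le (d * m)]))
    (hd I m (by nlinarith [Nat.zero_le (c * m)]))

theorem IsOverconvergent.dvd_coeff {f : MvPowerSeries ι A} {c : ℕ}
    (hc : ∀ (I : ι →₀ ℕ) (m : ℕ), c * m < I.degree → (p : A) ^ m ∣ MvPowerSeries.coeff I f)
    (I : ι →₀ ℕ) : (p : A) ^ ((I.degree - 1) / (c + 1)) ∣ MvPowerSeries.coeff I f := by
  by_cases h0 : I.degree = 0
  · simp [h0]
  · apply hc
    have h1 : (c + 1) * ((I.degree - 1) / (c + 1)) ≤ I.degree - 1 := Nat.mul_div_le _ _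
    have h2 : c * ((I.degree - 1) / (c + 1)) ≤ (c + 1) * ((I.degree - 1) / (c + 1)) :=
      Nat.mul_le_mul_right _ (Nat.le_succ c)
    omega

theorem IsOverconvergent.mul {f g : MvPowerSeries ι A} (hf : IsOverconvergent p f)
    (hg : IsOverconvergent p g) : IsOverconvergent p (f * g) := by
  classical
  obtain ⟨c, hc⟩ := hf
  obtain ⟨d, hd⟩ := hg
  refine ⟨2 * (c + d + 1), fun I m h => ?_⟩
  rw [MvPowerSeries.coeff_mul]
  refine Finset.dvd_sum fun J hJ => ?_
  have hJ : J.1 + J.2 = I := Finset.HasAntidiagonal.mem_antidiagonal.mp hJ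
  have hdeg : J.1.degree + J.2.degree = I.degree := by rw [← hJ, map_add]
  have hcd : ∀ (K : ι →₀ ℕ) (n : ℕ), (c + d) * n < K.degree →
      (p : A) ^ n ∣ MvPowerSeries.coeff K f :=
    fun K n hK => hc K n (by nlinarith [Nat.zero_le (d * n)])
  have hdc : ∀ (K : ι →₀ ℕ) (n : ℕ), (c + d) * n < K.degree →
      (p : A) ^ n ∣ MvPowerSeries.coeff K g :=
    fun K n hK => hd K n (by nlinarith [Nat.zero_le (c * n)])
  have h1 := IsOverconvergent.dvd_coeff hcd J.1
  have h2 := IsOverconvergent.dvd_coeff hdc J.2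
  refine (pow_dvd_pow (p : A) ?_).trans ((pow_add (p : A) _ _).symm ▸ mul_dvd_mul h1 h2)
  rcases Nat.eq_zero_or_pos m with rfl | hm
  · exact Nat.zero_le _
  have he : 0 < c + d + 1 := Nat.succ_pos _
  clear hcd hdc hc hd
  generalize c + d + 1 = e at *
  have e1 := Nat.lt_mul_div_succ (J.1.degree - 1) he
  have e2 := Nat.lt_mul_div_succ (J.2.degree - 1) he
  by_contra hlt
  push Not at hlt
  generalize (J.1.degree - 1) / e = u at *
  generalize (J.2.degree - 1) / e = v at *
  have e3 : e * (u + v + 1) ≤ e * m := Nat.mul_le_mul_left e hlt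
  have e4 : e * 1 ≤ e * m := Nat.mul_le_mul_left e hm
  have e5 : J.1.degree ≤ e * (u + 1) := by omega
  have e6 : J.2.degree ≤ e * (v + 1) := by omega
  nlinarith

theorem IsOverconvergent.C (a : A) :
    IsOverconvergent p (algebraMap A (MvPowerSeries ι A) a) := by
  classical
  refine ⟨0, fun I m h => ?_⟩
  have hI : I ≠ 0 := by
    rintro rfl
    simp at h
  simp [MvPowerSeries.algebraMap_apply, MvPowerSeries.coeff_C, hI]

theorem IsOverconvergent.X (i : ι) :
    IsOverconvergent p (MvPowerSeries.X i : MvPowerSeries ι A) := by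
  classical
  refine ⟨1, fun I m h => ?_⟩
  rw [MvPowerSeries.coeff_X]
  split_ifs with hI
  · subst hI
    have : m = 0 := by simp at h; omega
    simp [this]
  · exact dvd_zero _

end closure

/-- The ring `A⟨x_i : i ∈ ι⟩†` of overconvergent power series. -/
def overconvergentSeries (p : ℕ) (ι A : Type*) [CommRing A] :
    Subalgebra A (MvPowerSeries ι A) where
  carrier := {f | IsOverconvergent p f}
  mul_mem' := IsOverconvergent.mul
  add_mem' := IsOverconvergent.add
  algebraMap_mem' := IsOverconvergent.C

/-- The variable `x_i` of `A⟨x_i : i ∈ ι⟩†`. -/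
def overconvergentSeries.var (p : ℕ) {ι : Type*} (A : Type*) [CommRing A] (i : ι) :
    overconvergentSeries p ι A :=
  ⟨MvPowerSeries.X i, IsOverconvergent.X i⟩

/-- `r` is a squarefree part `Δ / gcd (Δ, dΔ/dx)` of `Δ`, for some choice of the greatest common
divisor (which is only determined up to a unit). -/
def IsSquarefreePart {A : Type*} [CommRing A] (Δ r : A[X]) : Prop :=
  ∃ g : A[X], g ∣ Δ ∧ g ∣ derivative Δ ∧ (∀ d : A[X], d ∣ Δ → d ∣ derivative Δ → d ∣ g) ∧
    Δ = r * g

section ring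

variable (p : ℕ) {A : Type*} [CommRing A]

/-- The ideal `(z r(x) - 1, 𝒬(x, y))` of `A⟨x, z, y⟩†`; the variables `x`, `z`, `y` are those of
index `0`, `1`, `2`, and the outer variable of `A[X][Y]` is `y`. -/
def daggerIdeal (𝒬 : A[X][Y]) (r : A[X]) : Ideal (overconvergentSeries p (Fin 3) A) :=
  Ideal.span
    {overconvergentSeries.var p A 1 * aeval (overconvergentSeries.var p A (0 : Fin 3)) r - 1,
      aevalAeval (overconvergentSeries.var p A (0 : Fin 3)) (overconvergentSeries.var p A 2) 𝒬}

/-- The ring `ℛ† = A⟨x, 1/r, y⟩† / (𝒬)` of overconvergent functions. -/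
def Dagger (𝒬 : A[X][Y]) (r : A[X]) : Type _ :=
  overconvergentSeries p (Fin 3) A ⧸ daggerIdeal p 𝒬 r

instance (𝒬 : A[X][Y]) (r : A[X]) : CommRing (Dagger p 𝒬 r) :=
  inferInstanceAs (CommRing (overconvergentSeries p (Fin 3) A ⧸ daggerIdeal p 𝒬 r))

instance (𝒬 : A[X][Y]) (r : A[X]) : Algebra A (Dagger p 𝒬 r) :=
  inferInstanceAs (Algebra A (overconvergentSeries p (Fin 3) A ⧸ daggerIdeal p 𝒬 r))

/-- The quotient map `A⟨x, z, y⟩† → ℛ†`. -/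
def Dagger.mk (𝒬 : A[X][Y]) (r : A[X]) :
    overconvergentSeries p (Fin 3) A →ₐ[A] Dagger p 𝒬 r :=
  Ideal.Quotient.mkₐ A (daggerIdeal p 𝒬 r)

/-- The element `x` of `ℛ†`. -/
def Dagger.x (𝒬 : A[X][Y]) (r : A[X]) : Dagger p 𝒬 r :=
  Dagger.mk p 𝒬 r (overconvergentSeries.var p A 0)

/-- The element `1/r` of `ℛ†`. -/
def Dagger.rInv (𝒬 : A[X][Y]) (r : A[X]) : Dagger p 𝒬 r :=
  Dagger.mk p 𝒬 r (overconvergentSeries.var p A 1)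

/-- The element `y` of `ℛ†`. -/
def Dagger.y (𝒬 : A[X][Y]) (r : A[X]) : Dagger p 𝒬 r :=
  Dagger.mk p 𝒬 r (overconvergentSeries.var p A 2)

/-- A Frobenius lift on an `A`-algebra `B`: a `σ`-semilinear ring endomorphism that reduces
modulo `p` to the `p`-th power map. -/
structure IsFrobeniusLift {B : Type*} [CommRing B] [Algebra A B] (σ : A →+* A)
    (φ : B →+* B) : Prop where
  semilinear : ∀ (a : A) (b : B), φ (a • b) = σ a • φ b
  reduction : ∀ b : B, φ b - b ^ p ∈ Ideal.span {(p : B)}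

/-- Sequences `α`, `β` in `ℛ†` with `α₀ = 1/r^p`, `β₀ = y^p` and, modulo `p ^ (2 ^ (i + 1))`,
`α_{i+1} = α_i (2 - α_i r^σ(x^p))` and
`β_{i+1} = β_i - 𝒬^σ(x^p, β_i) s^σ(x^p, β_i) α_i`. -/
structure IsNewtonIteration (σ : A →+* A) (𝒬 s : A[X][Y]) (r : A[X])
    (α β : ℕ → Dagger p 𝒬 r) : Prop where
  alpha_zero : α 0 = Dagger.rInv p 𝒬 r ^ p
  beta_zero : β 0 = Dagger.y p 𝒬 r ^ p
  alpha_succ : ∀ i, (p : Dagger p 𝒬 r) ^ 2 ^ (i + 1) ∣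
    α (i + 1) - α i * (2 - α i * aeval (Dagger.x p 𝒬 r ^ p) (r.map σ))
  beta_succ : ∀ i, (p : Dagger p 𝒬 r) ^ 2 ^ (i + 1) ∣
    β (i + 1) - (β i - aevalAeval (Dagger.x p 𝒬 r ^ p) (β i) (𝒬.map (mapRingHom σ)) *
      aevalAeval (Dagger.x p 𝒬 r ^ p) (β i) (s.map (mapRingHom σ)) * α i)

end ring

end FrobLift

end

namespace FrobLift

/-! ### Limits and divisibility by powers of p, coefficient by coefficient. -/

section dvd

/-! A Frobenius lift with x ↦ x^p must send 1/r to an inverse of r^σ(x^p), and y to a root of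
𝒬^σ(x^p, ·). Modulo p these are solved by 1/r^p and y^p, so the task is Hensel lifting inside ℛ†,
which is not p-adically complete. The substitute for completeness is that every equation t = a + p
P(t) has an overconvergent solution (`overconvergentSeries.exists_eq_add_mul_eval`): the iterates
obey one common growth bound. This property passes to the quotient ℛ† and yields inverses and simple
roots (`SolvesContractions.exists_root`).

The root is simple because ∂𝒬/∂y is a unit of ℛ† (`isUnit_aevalAeval_derivative`): it divides Δ
modulo 𝒬, and Δ divides a power of r since its reduction modulo p is nonzero. Substitution of
overconvergent series turns the images of x, 1/r, y into a ring homomorphism, and the p-th power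
congruence need only be checked on generators.

Finally, Newton's iteration converges quadratically to the images under any such lift
(`IsNewtonIteration.dvd_sub`), so the lift can be fixed before s, α and β. -/

theorem exists_adic_limit {A : Type*} [CommRing A] (a : A) [IsAdicComplete (Ideal.span {a}) A]
    (u : ℕ → A) (hu : ∀ n, a ^ n ∣ u (n + 1) - u n) : ∃ l, ∀ n, a ^ n ∣ l - u n := by
  have key : ∀ {m n}, m ≤ n → a ^ m ∣ u m - u n := by
    intro m n hmn
    induction n, hmn using Nat.le_induction with
    | base => simp
    | succ n hmn ih =>
      have := dvd_sub ih ((pow_dvd_pow a hmn).trans (hu n))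
      convert this using 1
      ring
  obtain ⟨l, hl⟩ := IsPrecomplete.prec' (I := Ideal.span {a}) u fun {m n} hmn => by
    rw [SModEq.sub_mem, Ideal.span_singleton_pow]
    simpa [Ideal.mem_span_singleton] using key hmn
  refine ⟨l, fun n => ?_⟩
  have := hl n
  rw [SModEq.sub_mem, Ideal.span_singleton_pow] at this
  rw [dvd_sub_comm]
  simpa [Ideal.mem_span_singleton] using this

theorem eq_zero_of_forall_pow_dvd {A : Type*} [CommRing A] (a : A)
    [IsAdicComplete (Ideal.span {a}) A] {x : A} (hx : ∀ n, a ^ n ∣ x) : x = 0 := by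
  refine IsHausdorff.haus' (I := Ideal.span {a}) x fun n => ?_
  rw [SModEq.sub_mem, Ideal.span_singleton_pow]
  simpa [Ideal.mem_span_singleton] using hx n

variable {p : ℕ} {A ι : Type*} [CommRing A]

theorem coeff_natCast_pow_mul (n : ℕ) (f : MvPowerSeries ι A) (I : ι →₀ ℕ) :
    MvPowerSeries.coeff I ((p : MvPowerSeries ι A) ^ n * f) =
      (p : A) ^ n * MvPowerSeries.coeff I f := by
  rw [← MvPowerSeries.coeff_C_mul]
  simp

theorem natCast_pow_dvd_iff {n : ℕ} {f : MvPowerSeries ι A} :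
    (p : MvPowerSeries ι A) ^ n ∣ f ↔ ∀ I, (p : A) ^ n ∣ MvPowerSeries.coeff I f := by
  constructor
  · rintro ⟨g, rfl⟩ I
    rw [coeff_natCast_pow_mul]
    exact dvd_mul_right _ _
  · intro h
    choose v hv using h
    obtain ⟨g, hg⟩ : ∃ g : MvPowerSeries ι A, ∀ I, MvPowerSeries.coeff I g = v I :=
      ⟨v, fun _ => rfl⟩
    refine ⟨g, ?_⟩
    ext I
    rw [coeff_natCast_pow_mul, hv, hg]

theorem MvPowerSeries.eq_zero_of_forall_pow_dvd [IsAdicComplete (Ideal.span {(p : A)}) A]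
    {f : MvPowerSeries ι A} (hf : ∀ n, (p : MvPowerSeries ι A) ^ n ∣ f) : f = 0 := by
  ext I
  exact FrobLift.eq_zero_of_forall_pow_dvd (p : A) fun n => natCast_pow_dvd_iff.mp (hf n) I

theorem MvPowerSeries.exists_adic_limit [IsAdicComplete (Ideal.span {(p : A)}) A]
    (u : ℕ → MvPowerSeries ι A) (hu : ∀ n, (p : MvPowerSeries ι A) ^ n ∣ u (n + 1) - u n) :
    ∃ l, ∀ n, (p : MvPowerSeries ι A) ^ n ∣ l - u n := by
  have h : ∀ I, ∃ l, ∀ n, (p : A) ^ n ∣ l - MvPowerSeries.coeff I (u n) := fun I =>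
    FrobLift.exists_adic_limit (p : A) _ fun n => by
      simpa using natCast_pow_dvd_iff.mp (hu n) I
  choose v hv using h
  obtain ⟨l, hl⟩ : ∃ l : MvPowerSeries ι A, ∀ I, MvPowerSeries.coeff I l = v I := ⟨v, fun _ => rfl⟩
  refine ⟨l, fun n => natCast_pow_dvd_iff.mpr fun I => ?_⟩
  rw [map_sub, hl]
  exact hv I n

end dvd

/-! ### Quantitative growth bounds with additive weights. -/

section growth

variable {A ι : Type*} [CommRing A]

/-- The growth condition `|I| ≤ c (N ord_p (a_I) + w)` on the coefficients `a_I` of `f`. -/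
def HasGrowth (p c N w : ℕ) (f : MvPowerSeries ι A) : Prop :=
  ∀ I : ι →₀ ℕ, ∃ v, (p : A) ^ v ∣ MvPowerSeries.coeff I f ∧ I.degree ≤ c * (N * v + w)

variable {p c c' N w w' : ℕ} {f g : MvPowerSeries ι A}

theorem HasGrowth.mono (hf : HasGrowth p c N w f) (hc : c ≤ c') (hw : w ≤ w') :
    HasGrowth p c' N w' f := fun I => by
  obtain ⟨v, hv, h⟩ := hf I
  exact ⟨v, hv, h.trans (by gcongr)⟩

theorem exists_dvd_add_of_le {a b : A} {P : ℕ → Prop} {x : A} (ha : ∃ v, x ^ v ∣ a ∧ P v)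
    (hb : ∃ v, x ^ v ∣ b ∧ P v) : ∃ v, x ^ v ∣ a + b ∧ P v := by
  obtain ⟨v, hv, h⟩ := ha
  obtain ⟨v', hv', h'⟩ := hb
  rcases le_total v v' with hle | hle
  · exact ⟨v, dvd_add hv ((pow_dvd_pow x hle).trans hv'), h⟩
  · exact ⟨v', dvd_add ((pow_dvd_pow x hle).trans hv) hv', h'⟩

theorem HasGrowth.add (hf : HasGrowth p c N w f) (hg : HasGrowth p c N w g) :
    HasGrowth p c N w (f + g) := fun I => by
  rw [map_add]
  exact exists_dvd_add_of_le (hf I) (hg I)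

theorem HasGrowth.C (hc : 0 < c) (hN : 0 < N) (w : ℕ) (a : A) :
    HasGrowth p c N w (MvPowerSeries.C a : MvPowerSeries ι A) := fun I => by
  classical
  rw [MvPowerSeries.coeff_C]
  split_ifs with h
  · exact ⟨0, by simp, by simp [h]⟩
  · refine ⟨I.degree, dvd_zero _, ?_⟩
    nlinarith [Nat.mul_pos hc hN, Nat.mul_le_mul_right I.degree (Nat.mul_pos hc hN),
      Nat.zero_le (c * w)]

theorem HasGrowth.zero (hc : 0 < c) (hN : 0 < N) (w : ℕ) :
    HasGrowth p c N w (0 : MvPowerSeries ι A) :=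
  map_zero (MvPowerSeries.C (σ := ι) (R := A)) ▸ HasGrowth.C hc hN w 0

theorem HasGrowth.one (hc : 0 < c) (hN : 0 < N) (w : ℕ) :
    HasGrowth p c N w (1 : MvPowerSeries ι A) :=
  map_one (MvPowerSeries.C (σ := ι) (R := A)) ▸ HasGrowth.C hc hN w 1

theorem HasGrowth.sum (hc : 0 < c) (hN : 0 < N) {κ : Type*} (s : Finset κ)
    (F : κ → MvPowerSeries ι A) (hF : ∀ i ∈ s, HasGrowth p c N w (F i)) :
    HasGrowth p c N w (∑ i ∈ s, F i) :=
  Finset.sum_induction F _ (fun _ _ h h' => h.add h') (HasGrowth.zero hc hN w) hF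

theorem HasGrowth.mul (hc : 0 < c) (hN : 0 < N) (hf : HasGrowth p c N w f)
    (hg : HasGrowth p c N w' g) : HasGrowth p c N (w + w') (f * g) := fun I => by
  classical
  rw [MvPowerSeries.coeff_mul]
  refine Finset.sum_induction _ (fun a => ∃ v, (p : A) ^ v ∣ a ∧ I.degree ≤ c * (N * v + (w + w')))
    (fun _ _ => exists_dvd_add_of_le) ?_ fun J hJ => ?_
  · refine ⟨I.degree, dvd_zero _, ?_⟩
    nlinarith [Nat.mul_le_mul_right I.degree (Nat.mul_pos hc hN), Nat.zero_le (c * (w + w'))]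
  · obtain ⟨v, hv, h⟩ := hf J.1
    obtain ⟨v', hv', h'⟩ := hg J.2
    refine ⟨v + v', by rw [pow_add]; exact mul_dvd_mul hv hv', ?_⟩
    rw [← Finset.HasAntidiagonal.mem_antidiagonal.mp hJ, map_add]
    calc _ ≤ _ := add_le_add h h'
      _ = _ := by ring

theorem HasGrowth.pow (hc : 0 < c) (hN : 0 < N) (hf : HasGrowth p c N w f) (n : ℕ) :
    HasGrowth p c N (n * w) (f ^ n) := by
  induction n with
  | zero => simpa using HasGrowth.one hc hN 0
  | succ n ih =>
    rw [pow_succ, add_mul, one_mul]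
    exact ih.mul hc hN hf

theorem HasGrowth.prod_pow (hc : 0 < c) (hN : 0 < N) {κ : Type*} (s : Finset κ)
    {F : κ → MvPowerSeries ι A} (hF : ∀ i, HasGrowth p c N 1 (F i)) (e : κ → ℕ) :
    HasGrowth p c N (∑ i ∈ s, e i) (∏ i ∈ s, F i ^ e i) := by
  classical
  induction s using Finset.induction_on with
  | empty => simpa using HasGrowth.one hc hN 0
  | insert i s hi ih =>
    rw [Finset.prod_insert hi, Finset.sum_insert hi]
    exact HasGrowth.mul hc hN (by simpa using (hF i).pow hc hN (e i)) ih

theorem HasGrowth.of_pow_dvd {u : ℕ} {a : A} (ha : (p : A) ^ u ∣ a) (hf : HasGrowth p c N w f)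
    (hw : w ≤ w' + N * u) : HasGrowth p c N w' (MvPowerSeries.C a * f) := fun I => by
  obtain ⟨v, hv, h⟩ := hf I
  refine ⟨u + v, ?_, h.trans ?_⟩
  · rw [MvPowerSeries.coeff_C_mul, pow_add]
    exact mul_dvd_mul ha hv
  · refine Nat.mul_le_mul_left c ?_
    rw [mul_add]
    omega

/-- Weights add under products, while a factor p pays for N units of weight. With N large compared
to the degree of P, this lets t ↦ a + p P(t) preserve a fixed bound. -/
theorem HasGrowth.natCast_mul (hf : HasGrowth p c N w f) (hw : w ≤ w' + N) :
    HasGrowth p c N w' ((p : MvPowerSeries ι A) * f) := by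
  have := hf.of_pow_dvd (u := 1) (a := (p : A)) (w' := w') (by simp) (by simpa using hw)
  simpa using this

/-- At the index I, precision p^|I| is enough, because |I| ≤ c N |I|. -/
theorem HasGrowth.of_limit (hc : 0 < c) (hN : 0 < N) {u : ℕ → MvPowerSeries ι A}
    (hu : ∀ n, HasGrowth p c N w (u n)) (hf : ∀ n, (p : MvPowerSeries ι A) ^ n ∣ f - u n) :
    HasGrowth p c N w f := fun I => by
  have h := exists_dvd_add_of_le (P := fun v => I.degree ≤ c * (N * v + w))
    ⟨I.degree, natCast_pow_dvd_iff.mp (hf I.degree) I, ?_⟩ (hu I.degree I)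
  · simpa using h
  · nlinarith [Nat.mul_le_mul_right I.degree (Nat.mul_pos hc hN), Nat.zero_le (c * w)]

theorem HasGrowth.isOverconvergent (hf : HasGrowth p c N w f) : IsOverconvergent p f := by
  refine ⟨c * (N + w), fun I m hm => ?_⟩
  obtain ⟨v, hv, h⟩ := hf I
  refine (pow_dvd_pow _ ?_).trans hv
  by_contra! hlt
  have h1 : N * v + w ≤ (N + w) * m := by
    nlinarith [Nat.mul_le_mul_left N hlt.le, Nat.mul_le_mul_left w (show 1 ≤ m by omega)]
  have := Nat.mul_le_mul_left c h1
  rw [← mul_assoc] at this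
  omega

theorem IsOverconvergent.exists_dvd_coeff (hf : IsOverconvergent p f) :
    ∃ c, ∀ I : ι →₀ ℕ, ∃ v, (p : A) ^ v ∣ MvPowerSeries.coeff I f ∧ I.degree ≤ c * (v + 1) := by
  obtain ⟨c, hc⟩ := hf
  refine ⟨c + 1, fun I => ⟨_, IsOverconvergent.dvd_coeff hc I, ?_⟩⟩
  have := Nat.lt_mul_div_succ (I.degree - 1) (Nat.succ_pos c)
  simp only [Nat.succ_eq_add_one] at this
  omega

/-- The constant c does not depend on N, so N may be chosen later to suit the polynomial or series
into which f is inserted. -/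
theorem IsOverconvergent.exists_hasGrowth (hf : IsOverconvergent p f) :
    ∃ c, ∀ N, 0 < N → HasGrowth p c N 1 f := by
  obtain ⟨c, hc⟩ := hf.exists_dvd_coeff
  refine ⟨c, fun N hN I => ?_⟩
  obtain ⟨v, hv, h⟩ := hc I
  exact ⟨v, hv, h.trans (by gcongr; exact Nat.le_mul_of_pos_left v hN)⟩

theorem exists_hasGrowth_of_finset {κ : Type*} (s : Finset κ) (F : κ → MvPowerSeries ι A)
    (hF : ∀ i, IsOverconvergent p (F i)) :
    ∃ c, 0 < c ∧ ∀ i ∈ s, ∀ N, 0 < N → HasGrowth p c N 1 (F i) := by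
  choose c hc using fun i => (hF i).exists_hasGrowth
  refine ⟨s.sup c + 1, Nat.succ_pos _, fun i hi N hN => (hc i N hN).mono ?_ le_rfl⟩
  exact (Finset.le_sup hi).trans (Nat.le_succ _)

end growth

/-! ### Contracting equations over overconvergent series. -/

section fixedPoint

variable {p : ℕ} {A ι : Type*} [CommRing A]

/-- Contracting polynomial equations can be solved in the ring of overconvergent series. -/
theorem overconvergentSeries.exists_eq_add_mul_eval [IsAdicComplete (Ideal.span {(p : A)}) A]
    (a : overconvergentSeries p ι A) (P : (overconvergentSeries p ι A)[X]) :
    ∃ t, t = a + (p : overconvergentSeries p ι A) * P.eval t := by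
  obtain ⟨c, hc, hcP⟩ := exists_hasGrowth_of_finset (p := p)
    (Finset.range (P.natDegree + 1)) (fun i => (P.coeff i : MvPowerSeries ι A))
    (fun i => (P.coeff i).2)
  obtain ⟨c', hca⟩ := IsOverconvergent.exists_hasGrowth a.2
  set d := c + c' with hd
  have hd0 : 0 < d := by omega
  -- A coefficient of weight 1 times at most deg P factors of weight 1 has weight at most N, and the
  -- factor p absorbs N. So weight 1 is preserved by the iteration.
  set N := P.natDegree + 1 with hN
  have hN0 : 0 < N := Nat.succ_pos _
  obtain ⟨u, hu0, hu⟩ : ∃ u : ℕ → overconvergentSeries p ι A, u 0 = a ∧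
      ∀ n, u (n + 1) = a + (p : overconvergentSeries p ι A) * P.eval (u n) :=
    ⟨fun n => Nat.rec a (fun _ t => a + (p : overconvergentSeries p ι A) * P.eval t) n, rfl,
      fun _ => rfl⟩
  have ha : HasGrowth p d N 1 (a : MvPowerSeries ι A) := (hca N hN0).mono (by omega) le_rfl
  have hug : ∀ n, HasGrowth p d N 1 (u n : MvPowerSeries ι A) := by
    intro n
    induction n with
    | zero => rw [hu0]; exact ha
    | succ n ih =>
      rw [hu]
      push_cast
      refine ha.add (HasGrowth.natCast_mul (w := N) ?_ (by omega))
      rw [eval_eq_sum_range]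
      push_cast
      refine HasGrowth.sum hd0 hN0 _ _ fun i hi => ?_
      refine (HasGrowth.mul hd0 hN0 ((hcP i hi N hN0).mono (by omega) le_rfl)
        (ih.pow hd0 hN0 i)).mono le_rfl ?_
      have := Finset.mem_range.mp hi
      omega
  have hdvd : ∀ n, (p : overconvergentSeries p ι A) ^ n ∣ u (n + 1) - u n := by
    intro n
    induction n with
    | zero => simp
    | succ n ih =>
      have h : u (n + 1 + 1) - u (n + 1) =
          (p : overconvergentSeries p ι A) * (P.eval (u (n + 1)) - P.eval (u n)) := by
        linear_combination hu (n + 1) - hu n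
      rw [h, pow_succ']
      exact mul_dvd_mul_left _ (ih.trans (sub_dvd_eval_sub _ _ P))
  have hval : ∀ n, (p : MvPowerSeries ι A) ^ n ∣
      (u (n + 1) : MvPowerSeries ι A) - (u n : MvPowerSeries ι A) := fun n => by
    simpa using map_dvd (overconvergentSeries p ι A).val (hdvd n)
  obtain ⟨l, hl⟩ := MvPowerSeries.exists_adic_limit (fun n => (u n : MvPowerSeries ι A)) hval
  refine ⟨⟨l, (HasGrowth.of_limit hd0 hN0 (u := fun n => (u n : MvPowerSeries ι A)) hug hl).isOverconvergent⟩, ?_⟩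
  set t : overconvergentSeries p ι A :=
    ⟨l, (HasGrowth.of_limit hd0 hN0 (u := fun n => (u n : MvPowerSeries ι A)) hug hl).isOverconvergent⟩
  rw [← sub_eq_zero]
  refine Subtype.ext (MvPowerSeries.eq_zero_of_forall_pow_dvd (p := p) fun n => ?_)
  have h1 := (pow_dvd_pow (p : MvPowerSeries ι A) (Nat.le_succ n)).trans (hl (n + 1))
  have h2 : (p : MvPowerSeries ι A) ^ n ∣
      ((P.eval (u n) : overconvergentSeries p ι A) : MvPowerSeries ι A) - (P.eval t :) := by
    have h3 := map_dvd (overconvergentSeries p ι A).val (sub_dvd_eval_sub (u n) t P)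
    rw [map_sub, map_sub] at h3
    exact ((dvd_sub_comm.mp (hl n))).trans h3
  have h4 := dvd_add h1 (h2.mul_left (p : MvPowerSeries ι A))
  convert h4 using 1
  rw [hu]
  push_cast
  change l - _ = l - _ + _
  ring

end fixedPoint

/-! ### Semilinear substitution of overconvergent series. -/

section substitution

variable {p : ℕ} {A ι : Type*} [CommRing A]

theorem natCast_pow_dvd_eval₂Hom {R : Type*} [CommRing R] (θ : A →+* R) (b : ι → R) {n : ℕ}
    {P : MvPolynomial ι A} (hP : (p : MvPowerSeries ι A) ^ n ∣ (P : MvPowerSeries ι A)) :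
    (p : R) ^ n ∣ MvPolynomial.eval₂Hom θ b P := by
  have h : MvPolynomial.C ((p : A) ^ n) ∣ P := by
    rw [MvPolynomial.C_dvd_iff_dvd_coeff]
    intro I
    simpa using natCast_pow_dvd_iff.mp hP I
  simpa using map_dvd (MvPolynomial.eval₂Hom θ b) h

/-- Every overconvergent series is a `p`-adic limit of its truncations. -/
theorem natCast_pow_dvd_sub_truncTotal [Finite ι] {f : MvPowerSeries ι A} {c : ℕ}
    (hc : ∀ I : ι →₀ ℕ, ∃ v, (p : A) ^ v ∣ MvPowerSeries.coeff I f ∧ I.degree ≤ c * (v + 1))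
    (n : ℕ) : (p : MvPowerSeries ι A) ^ n ∣
      f - (MvPowerSeries.truncTotal (c * (n + 1) + 1) f : MvPolynomial ι A) := by
  rw [natCast_pow_dvd_iff]
  intro I
  rw [map_sub, MvPolynomial.coeff_coe, MvPowerSeries.coeff_truncTotal_eq_ite]
  split_ifs with h
  · simp
  · rw [sub_zero]
    obtain ⟨v, hv, hI⟩ := hc I
    refine (pow_dvd_pow _ ?_).trans hv
    by_contra! hlt
    have := Nat.mul_le_mul_left c (show v + 1 ≤ n + 1 by omega)
    omega

/-- The monomial b^I has weight |I| ≤ c v + c, and p^v dividing its coefficient pays for N v ≥ c v.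
The remaining weight c is the same for all truncations. -/
theorem HasGrowth.eval₂Hom_truncTotal [Finite ι] (σ : A →+* A) {b : ι → MvPowerSeries ι A}
    {f : MvPowerSeries ι A} {c d N : ℕ}
    (hc : ∀ I : ι →₀ ℕ, ∃ v, (p : A) ^ v ∣ MvPowerSeries.coeff I f ∧ I.degree ≤ c * (v + 1))
    (hd : 0 < d) (hN : 0 < N) (hcN : c ≤ N) (hb : ∀ i, HasGrowth p d N 1 (b i)) (n : ℕ) :
    HasGrowth p d N c (MvPolynomial.eval₂Hom (MvPowerSeries.C.comp σ) b
      (MvPowerSeries.truncTotal n f)) := by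
  rw [MvPolynomial.coe_eval₂Hom, MvPolynomial.eval₂_eq]
  refine HasGrowth.sum hd hN _ _ fun I _ => ?_
  rw [MvPowerSeries.coeff_truncTotal_eq_ite]
  split_ifs with h
  · obtain ⟨v, hv, hI⟩ := hc I
    refine HasGrowth.of_pow_dvd (u := v) ?_ (HasGrowth.prod_pow hd hN I.support hb I) ?_
    · simpa using map_dvd σ hv
    · refine hI.trans ?_
      nlinarith [Nat.mul_le_mul_right v hcN]
  · simpa using HasGrowth.zero hd hN c

/-- Substitution of overconvergent series into overconvergent series, semilinear over `σ`. -/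
theorem overconvergentSeries.exists_substitution [Finite ι]
    [IsAdicComplete (Ideal.span {(p : A)}) A] (σ : A →+* A)
    (b : ι → overconvergentSeries p ι A) :
    ∃ ψ : overconvergentSeries p ι A →+* overconvergentSeries p ι A,
      (∀ a, ψ (algebraMap A _ a) = algebraMap A _ (σ a)) ∧
      ∀ i, ψ (overconvergentSeries.var p A i) = b i := by
  cases nonempty_fintype ι
  obtain ⟨ev, hev⟩ : ∃ ev, ev = MvPolynomial.eval₂Hom
    ((MvPowerSeries.C (σ := ι) (R := A)).comp σ) (fun i => (b i : MvPowerSeries ι A)) := ⟨_, rfl⟩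
  obtain ⟨d, hd, hb⟩ := exists_hasGrowth_of_finset Finset.univ
    (fun i => (b i : MvPowerSeries ι A)) fun i => (b i).2
  -- The graph of the substitution: g is the p-adic limit of the values of polynomials approximating
  -- f. It is single-valued and compatible with sums and products, so the homomorphism laws follow
  -- from uniqueness.
  let Rel (f g : overconvergentSeries p ι A) : Prop := ∀ n, ∃ P : MvPolynomial ι A,
    (p : MvPowerSeries ι A) ^ n ∣ (f : MvPowerSeries ι A) - (P : MvPowerSeries ι A) ∧
      (p : MvPowerSeries ι A) ^ n ∣ (g : MvPowerSeries ι A) - ev P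
  have hcongr : ∀ {n : ℕ} {f : MvPowerSeries ι A} {P P' : MvPolynomial ι A},
      (p : MvPowerSeries ι A) ^ n ∣ f - (P : MvPowerSeries ι A) →
      (p : MvPowerSeries ι A) ^ n ∣ f - (P' : MvPowerSeries ι A) →
      (p : MvPowerSeries ι A) ^ n ∣ ev P - ev P' := by
    intro n f P P' h h'
    rw [← map_sub, hev]
    refine natCast_pow_dvd_eval₂Hom _ _ ?_
    have := dvd_sub h' h
    rw [sub_sub_sub_cancel_left] at this
    rwa [← MvPolynomial.coeToMvPowerSeries.ringHom_apply, map_sub]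
  have huniq : ∀ {f g g'}, Rel f g → Rel f g' → g = g' := by
    intro f g g' h h'
    refine Subtype.ext (sub_eq_zero.mp (MvPowerSeries.eq_zero_of_forall_pow_dvd (p := p)
      fun n => ?_))
    obtain ⟨P, hP, hg⟩ := h n
    obtain ⟨P', hP', hg'⟩ := h' n
    have := dvd_add (dvd_sub hg hg') (hcongr hP hP')
    convert this using 1
    ring
  have hex : ∀ f, ∃ g, Rel f g := by
    intro f
    obtain ⟨c, hc⟩ := IsOverconvergent.exists_dvd_coeff f.2
    have hu := natCast_pow_dvd_sub_truncTotal hc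
    obtain ⟨g, hg⟩ := MvPowerSeries.exists_adic_limit (p := p)
      (fun n => ev (MvPowerSeries.truncTotal (c * (n + 1) + 1) (f : MvPowerSeries ι A)))
      fun n => hcongr ((pow_dvd_pow _ n.le_succ).trans (hu (n + 1))) (hu n)
    have hgrowth : HasGrowth p d (c + 1) c g :=
      HasGrowth.of_limit hd (Nat.succ_pos c) (fun n => by
        rw [hev]
        exact HasGrowth.eval₂Hom_truncTotal σ hc hd (Nat.succ_pos c) (Nat.le_succ c)
          (fun i => hb i (Finset.mem_univ i) _ (Nat.succ_pos c)) _) hg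
    exact ⟨⟨g, hgrowth.isOverconvergent⟩, fun n => ⟨_, hu n, hg n⟩⟩
  have hpoly : ∀ (P : MvPolynomial ι A) (f g : overconvergentSeries p ι A),
      (f : MvPowerSeries ι A) = P → (g : MvPowerSeries ι A) = ev P → Rel f g := by
    intro P f g hf hg n
    exact ⟨P, by simp [hf], by simp [hg]⟩
  choose ψ hψ using hex
  refine ⟨{ toFun := ψ, map_one' := ?_, map_mul' := ?_, map_zero' := ?_, map_add' := ?_ }, ?_, ?_⟩
  · exact huniq (hψ 1) (hpoly 1 _ _ (by simp) (by simp))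
  · intro f g
    refine huniq (hψ (f * g)) fun n => ?_
    obtain ⟨P, hP, hP'⟩ := hψ f n
    obtain ⟨Q, hQ, hQ'⟩ := hψ g n
    refine ⟨P * Q, ?_, ?_⟩
    · have := dvd_add (hP.mul_right (g : MvPowerSeries ι A)) (hQ.mul_left (P : MvPowerSeries ι A))
      convert this using 1
      push_cast
      ring
    · have := dvd_add (hP'.mul_right (ψ g : MvPowerSeries ι A)) (hQ'.mul_left (ev P))
      convert this using 1
      rw [map_mul]
      push_cast
      ring
  · exact huniq (hψ 0) (hpoly 0 _ _ (by simp) (by simp))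
  · intro f g
    refine huniq (hψ (f + g)) fun n => ?_
    obtain ⟨P, hP, hP'⟩ := hψ f n
    obtain ⟨Q, hQ, hQ'⟩ := hψ g n
    refine ⟨P + Q, ?_, ?_⟩
    · convert dvd_add hP hQ using 1
      push_cast
      ring
    · convert dvd_add hP' hQ' using 1
      rw [map_add]
      push_cast
      ring
  · intro a
    refine huniq (hψ _) (hpoly (MvPolynomial.C a) _ _ ?_ ?_)
    · simp [MvPowerSeries.algebraMap_apply]
    · simp [hev, MvPowerSeries.algebraMap_apply]
  · intro i
    refine huniq (hψ _) (hpoly (MvPolynomial.X i) _ _ ?_ ?_)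
    · simp [overconvergentSeries.var]
    · simp [hev]

end substitution

/-! ### Hensel's lemma from contracting equations. -/

section contracting

/-- Every contracting polynomial equation `t = a + p P(t)` over `B` has a solution. -/
def SolvesContractions (p : ℕ) (B : Type*) [CommRing B] : Prop :=
  ∀ (a : B) (P : B[X]), ∃ t, t = a + (p : B) * P.eval t

variable {p : ℕ} {B : Type*} [CommRing B]

/-- Solvability without uniqueness descends to every quotient, whether or not the quotient is
p-adically separated. -/
theorem SolvesContractions.of_surjective {B' : Type*} [CommRing B'] (hB : SolvesContractions p B)
    (π : B →+* B') (hπ : Function.Surjective π) : SolvesContractions p B' := by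
  intro a P
  obtain ⟨a, rfl⟩ := hπ a
  obtain ⟨P, rfl⟩ := Polynomial.map_surjective π hπ P
  obtain ⟨t, ht⟩ := hB a P
  refine ⟨π t, ?_⟩
  conv_lhs => rw [ht]
  simp [eval_map, eval₂_at_apply]

theorem SolvesContractions.isUnit_of_dvd_mul_sub_one (hB : SolvesContractions p B) {u v : B}
    (h : (p : B) ∣ u * v - 1) : IsUnit u := by
  obtain ⟨w, hw⟩ := h
  obtain ⟨t, ht⟩ := hB 1 (C (-w) * X)
  simp only [eval_mul, eval_C, eval_X] at ht
  exact IsUnit.of_mul_eq_one (v * t) (by linear_combination ht + t * hw)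

/-- Hensel's lemma modulo `p` for a simple root. -/
theorem SolvesContractions.exists_root (hB : SolvesContractions p B) (F : B[X]) {y : B}
    (hF : (p : B) ∣ F.eval y) (hF' : IsUnit (F.derivative.eval y)) :
    ∃ t, F.eval t = 0 ∧ (p : B) ∣ t - y := by
  obtain ⟨h, hh⟩ := hF
  obtain ⟨w, hw⟩ := hF'.exists_right_inv
  -- The Taylor expansion is taken over B[X], with indeterminate increment p X, so that the
  -- remainder k is a polynomial in the unknown. Dividing F(y + p t) = 0 by p F'(y) gives the
  -- contraction solved next; only its multiple by p is used, so p may be a zero divisor.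
  obtain ⟨k, hk⟩ := binomExpansion (F.map C) (C y) (C (p : B) * X)
  obtain ⟨t, ht⟩ := hB (-(w * h)) (C (-w) * k * X ^ 2)
  have hk' := congr_arg (Polynomial.eval t) hk
  rw [derivative_map, eval_map, eval_map, eval_map, eval₂_at_apply, eval₂_at_apply,
    ← coe_evalRingHom, hom_eval₂] at hk'
  simp only [map_add, map_mul, map_pow, coe_evalRingHom, eval_C, eval_X] at hk'
  have hid : (evalRingHom t).comp C = RingHom.id B := by ext; simp
  rw [hid] at hk'
  refine ⟨y + p * t, ?_, ⟨t, by ring⟩⟩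
  have he : F.eval (y + p * t) = F.eval y + F.derivative.eval y * (p * t) +
      k.eval t * (p * t) ^ 2 := by simpa [eval₂_id] using hk'
  rw [he, hh]
  simp only [eval_mul, eval_C, eval_X, eval_pow] at ht
  linear_combination (F.derivative.eval y * p) * ht +
    (-(p : B) * h - p ^ 2 * k.eval t * t ^ 2) * hw

end contracting

/-! ### The p-th power congruence on polynomials. -/

section frobenius

/-- The elements on which `φ` is congruent modulo `p` to the `p`-th power of `θ`. -/
def frobeniusCongruence (p : ℕ) [Fact p.Prime] {B B' : Type*} [CommRing B] [CommRing B']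
    (φ θ : B →+* B') : Subsemiring B where
  carrier := {b | (p : B') ∣ φ b - θ b ^ p}
  one_mem' := by simp
  zero_mem' := by simp [(Fact.out : p.Prime).ne_zero]
  mul_mem' := fun {a b} ha hb => by
    have := dvd_add (ha.mul_right (φ b)) (hb.mul_left (θ a ^ p))
    change (p : B') ∣ _ - _
    convert this using 1
    rw [map_mul, map_mul]
    ring
  add_mem' := fun {a b} ha hb => by
    obtain ⟨r, hr⟩ := exists_add_pow_prime_eq (Fact.out : p.Prime) (θ a) (θ b)
    have := dvd_sub (dvd_add ha hb) ((dvd_mul_right (p : B') (θ a * θ b * r)))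
    change (p : B') ∣ _ - _
    convert this using 1
    rw [map_add, map_add, hr]
    ring

variable {p : ℕ} {A B : Type*} [CommRing A] [CommRing B] [Algebra A B]

theorem ringHom_bivariate_ext {A B : Type*} [CommRing A] [CommRing B] {φ ψ : A[X][Y] →+* B}
    (hC : ∀ a, φ (C (C a)) = ψ (C (C a))) (hX : φ (C X) = ψ (C X)) (hY : φ Y = ψ Y) : φ = ψ :=
  Polynomial.ringHom_ext' (Polynomial.ringHom_ext' (RingHom.ext hC) hX) hY

theorem aevalAeval_eq_eval_map (x y : B) (F : A[X][Y]) :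
    aevalAeval x y F = (F.map (aeval x : A[X] →ₐ[A] B).toRingHom).eval y := by
  have : (aevalAeval x y : A[X][Y] →ₐ[A] B).toRingHom =
      (evalRingHom y).comp (mapRingHom (aeval x : A[X] →ₐ[A] B).toRingHom) :=
    ringHom_bivariate_ext (by simp) (by simp) (by simp)
  exact RingHom.congr_fun this F

theorem map_aevalAeval {B' : Type*} [CommRing B'] [Algebra A B'] (σ : A →+* A) (φ : B →+* B')
    (hφ : ∀ a, φ (algebraMap A B a) = algebraMap A B' (σ a)) (x y : B) (F : A[X][Y]) :
    φ (aevalAeval x y F) = aevalAeval (φ x) (φ y) (F.map (mapRingHom σ)) := by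
  have : φ.comp (aevalAeval x y : A[X][Y] →ₐ[A] B).toRingHom =
      (aevalAeval (φ x) (φ y) : A[X][Y] →ₐ[A] B').toRingHom.comp (mapRingHom (mapRingHom σ)) :=
    ringHom_bivariate_ext (by simp [hφ]) (by simp) (by simp)
  exact RingHom.congr_fun this F

theorem map_aeval_semilinear {B' : Type*} [CommRing B'] [Algebra A B'] (σ : A →+* A)
    (φ : B →+* B') (hφ : ∀ a, φ (algebraMap A B a) = algebraMap A B' (σ a)) (x : B) (f : A[X]) :
    φ (aeval x f) = aeval (φ x) (f.map σ) := by
  simpa using map_aevalAeval σ φ hφ x 0 (C f)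

/-- The polynomials satisfying the congruence form a subsemiring containing the constants and both
variables. -/
theorem dvd_aevalAeval_sub_pow [Fact p.Prime] (σ : A →+* A) (hσ : ∀ a, (p : A) ∣ σ a - a ^ p)
    (x y : B) (F : A[X][Y]) :
    (p : B) ∣ aevalAeval (x ^ p) (y ^ p) (F.map (mapRingHom σ)) - aevalAeval x y F ^ p := by
  let S := frobeniusCongruence p
    ((aevalAeval (x ^ p) (y ^ p) : A[X][Y] →ₐ[A] B).toRingHom.comp (mapRingHom (mapRingHom σ)))
    (aevalAeval x y : A[X][Y] →ₐ[A] B).toRingHom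
  have hY : (Y : A[X][Y]) ∈ S := by
    change (p : B) ∣ _ - _
    simp
  have hX : (C X : A[X][Y]) ∈ S := by
    change (p : B) ∣ _ - _
    simp
  have hC : ∀ a, (C (C a) : A[X][Y]) ∈ S := by
    intro a
    change (p : B) ∣ _ - _
    simpa using map_dvd (algebraMap A B) (hσ a)
  have hCf : ∀ f : A[X], (C f : A[X][Y]) ∈ S := by
    intro f
    induction f using Polynomial.induction_on' with
    | add f g hf hg => rw [C_add]; exact S.add_mem hf hg
    | monomial n a =>
      rw [← C_mul_X_pow_eq_monomial, C_mul, C_pow]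
      exact S.mul_mem (hC a) (S.pow_mem hX n)
  have : F ∈ S := by
    induction F using Polynomial.induction_on' with
    | add f g hf hg => exact S.add_mem hf hg
    | monomial n a =>
      rw [← C_mul_X_pow_eq_monomial]
      exact S.mul_mem (hCf a) (S.pow_mem hY n)
  exact this

theorem dvd_aeval_sub_pow [Fact p.Prime] (σ : A →+* A) (hσ : ∀ a, (p : A) ∣ σ a - a ^ p)
    (x : B) (f : A[X]) : (p : B) ∣ aeval (x ^ p) (f.map σ) - aeval x f ^ p := by
  simpa using dvd_aevalAeval_sub_pow σ hσ x 0 (C f)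

end frobenius

/-! ### Discriminants and squarefree parts. -/

section discriminant

theorem exists_dvd_pow_of_prime_dvd {R : Type*} [CommRing R] [IsDomain R]
    [UniqueFactorizationMonoid R] {a r : R} (ha : a ≠ 0) (h : ∀ q, Prime q → q ∣ a → q ∣ r) :
    ∃ n, a ∣ r ^ n := by
  induction a using UniqueFactorizationMonoid.induction_on_prime with
  | h₁ => exact absurd rfl ha
  | h₂ u hu => exact ⟨0, hu.dvd⟩
  | h₃ a q ha' hq ih =>
    obtain ⟨n, hn⟩ := ih ha' fun q' hq' hd => h q' hq' (hd.mul_left q)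
    refine ⟨n + 1, ?_⟩
    rw [pow_succ']
    exact mul_dvd_mul (h q hq (dvd_mul_right _ _)) hn

/-- In characteristic zero, a polynomial divides a power of its squarefree part as soon as it has
no constant prime factor. -/
theorem IsSquarefreePart.exists_dvd_pow {A : Type*} [CommRing A] [IsDomain A] [CharZero A]
    [UniqueFactorizationMonoid A] {Δ r : A[X]} (hr : IsSquarefreePart Δ r) (hΔ : Δ ≠ 0)
    (hconst : ∀ a : A, Prime a → ¬ C a ∣ Δ) : ∃ n, Δ ∣ r ^ n := by
  obtain ⟨g, -, hg, -, hΔr⟩ := hr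
  refine exists_dvd_pow_of_prime_dvd hΔ fun q hq hqΔ => ?_
  have hdeg : q.natDegree ≠ 0 := by
    intro h0
    obtain ⟨a, rfl⟩ := natDegree_eq_zero.mp h0
    exact hconst a (Polynomial.prime_C_iff.mp hq) hqΔ
  have hfin : FiniteMultiplicity q Δ := FiniteMultiplicity.of_prime_left hq hΔ
  obtain ⟨h, hh, hqh⟩ := hfin.exists_eq_pow_mul_and_not_dvd
  obtain ⟨e, he⟩ : ∃ e, multiplicity q Δ = e + 1 := Nat.exists_eq_succ_of_ne_zero
    fun h0 => hqh (by rw [h0, pow_zero, one_mul] at hh; exact hh ▸ hqΔ)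
  rw [he] at hh
  by_contra hqr
  -- If q does not divide r, the full power of q in Δ = r g lies in g, hence in Δ'. But Δ' contains
  -- q only to the power e, since (e + 1) q' is nonzero of degree below that of q.
  have hpow : q ^ (e + 1) ∣ derivative Δ := by
    have h1 : q ^ (e + 1) ∣ r * g := hΔr ▸ hh ▸ dvd_mul_right _ _
    exact (hq.pow_dvd_of_dvd_mul_left _ hqr h1).trans hg
  have h2 : derivative Δ = q ^ e * (C ((e : A) + 1) * derivative q * h + q * derivative h) := by
    rw [hh, derivative_mul, derivative_pow_succ]
    ring
  rw [h2, pow_succ, mul_dvd_mul_iff_left (pow_ne_zero _ hq.ne_zero)] at hpow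
  have h3 : q ∣ C ((e : A) + 1) * derivative q * h := (dvd_add_left (dvd_mul_right _ _)).mp hpow
  have h4 : derivative q ≠ 0 := fun h0 => hdeg (derivative_eq_zero.mp h0)
  have h5 : (e : A) + 1 ≠ 0 := by exact_mod_cast Nat.succ_ne_zero e
  rcases hq.dvd_or_dvd h3 with h6 | h6
  · have h7 := natDegree_le_of_dvd h6 (mul_ne_zero (C_ne_zero.mpr h5) h4)
    rw [natDegree_C_mul h5] at h7
    have := natDegree_derivative_lt hdeg
    omega
  · exact hqh h6

theorem map_discr_of_monic {R S : Type*} [CommRing R] [CommRing S] [Nontrivial S] (f : R →+* S)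
    {P : R[X]} (hP : P.Monic) (hdeg : 0 < P.natDegree) : f P.discr = (P.map f).discr := by
  have := f.domain_nontrivial
  have h1 := resultant_deriv (natDegree_pos_iff_degree_pos.mp hdeg)
  have hn : (P.map f).natDegree = P.natDegree := hP.natDegree_map f
  have h2 := resultant_deriv (f := P.map f)
    (natDegree_pos_iff_degree_pos.mp (by rw [hn]; exact hdeg))
  rw [hn, derivative_map, resultant_map_map, h1, (hP.map f).leadingCoeff, hP.leadingCoeff] at h2
  simp only [map_mul, map_pow, map_neg, map_one, mul_one] at h2
  rcases neg_one_pow_eq_or S (P.natDegree * (P.natDegree - 1) / 2) with h | h <;>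
    simpa [h] using h2

theorem discr_ne_zero_of_separable {K : Type*} [Field K] {P : K[X]} (hP : P.Monic)
    (hdeg : 0 < P.natDegree) (hs : P.Separable) : P.discr ≠ 0 := by
  intro h0
  have h1 := resultant_deriv (natDegree_pos_iff_degree_pos.mp hdeg)
  rw [h0, mul_zero] at h1
  -- In positive characteristic P' may have degree below deg P - 1. Padding its formal degree only
  -- multiplies the resultant by a power of the leading coefficient 1.
  obtain ⟨e, he⟩ := Nat.exists_eq_add_of_le (natDegree_derivative_le P)
  rw [he, resultant_add_right_deg _ _ _ _ _ le_rfl, hP.coeff_natDegree, one_pow, one_mul] at h1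
  exact resultant_ne_zero _ _ hs h1

/-- The discriminant of a monic polynomial is a combination of the polynomial and its
derivative. -/
theorem exists_mul_add_derivative_mul_eq_C_discr {R : Type*} [CommRing R] {P : R[X]}
    (hP : P.Monic) (hdeg : 0 < P.natDegree) :
    ∃ a b, P * a + P.derivative * b = C P.discr := by
  have h1 := resultant_deriv (natDegree_pos_iff_degree_pos.mp hdeg)
  obtain ⟨a, b, -, -, hab⟩ := exists_mul_add_mul_eq_C_resultant P P.derivative le_rfl
    (natDegree_derivative_le P) (Or.inl hdeg.ne')
  rw [h1, hP.leadingCoeff, mul_one] at hab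
  rcases neg_one_pow_eq_or R (P.natDegree * (P.natDegree - 1) / 2) with h | h
  · exact ⟨a, b, by simpa [h] using hab⟩
  · refine ⟨-a, -b, ?_⟩
    rw [h, neg_one_mul, C_neg] at hab
    linear_combination -hab

end discriminant

/-! ### Overconvergent series modulo p. -/

section polynomials

variable {p : ℕ} {A ι : Type*} [CommRing A]

theorem overconvergentSeries.coe_aeval_var (P : MvPolynomial ι A) :
    ((MvPolynomial.aeval (overconvergentSeries.var p A) P : overconvergentSeries p ι A) :
      MvPowerSeries ι A) = P := by
  induction P using MvPolynomial.induction_on with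
  | C a => simp [MvPowerSeries.algebraMap_apply]
  | add P Q hP hQ => simp [hP, hQ]
  | mul_X P i hP => simp [hP, overconvergentSeries.var]

/-- Modulo `p`, every overconvergent series is a polynomial. -/
theorem overconvergentSeries.exists_eq_aeval_var_add [Finite ι] [IsDomain A] (hp : (p : A) ≠ 0)
    (f : overconvergentSeries p ι A) :
    ∃ (P : MvPolynomial ι A) (h : overconvergentSeries p ι A), f = MvPolynomial.aeval (overconvergentSeries.var p A) P +
      (p : overconvergentSeries p ι A) * h := by
  obtain ⟨c, hc⟩ := IsOverconvergent.exists_dvd_coeff f.2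
  obtain ⟨P, hP⟩ : ∃ P : MvPolynomial ι A,
      (p : MvPowerSeries ι A) ^ 1 ∣ (f : MvPowerSeries ι A) - (P : MvPowerSeries ι A) :=
    ⟨_, natCast_pow_dvd_sub_truncTotal hc 1⟩
  obtain ⟨h, hh⟩ := hP
  obtain ⟨d, hd⟩ : IsOverconvergent p ((p : MvPowerSeries ι A) ^ 1 * h) := by
    rw [← hh, ← overconvergentSeries.coe_aeval_var (p := p) P]
    exact (f - MvPolynomial.aeval (overconvergentSeries.var p A) P).2
  have hover : IsOverconvergent p h := by
    -- Dividing by p costs one power, and d (m + 1) ≤ 2 d m for m ≥ 1.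
    refine ⟨2 * d, fun I m hm => ?_⟩
    rcases Nat.eq_zero_or_pos m with rfl | hm0
    · simp
    · have := hd I (m + 1) (lt_of_le_of_lt (by nlinarith [Nat.mul_le_mul_left d hm0]) hm)
      rwa [coeff_natCast_pow_mul, pow_one, pow_succ', mul_dvd_mul_iff_left hp] at this
  refine ⟨P, ⟨h, hover⟩, Subtype.ext ?_⟩
  push_cast
  rw [overconvergentSeries.coe_aeval_var]
  linear_combination hh

end polynomials

/-! ### Frobenius lifts and Newton iteration on ℛ†. -/

section dagger

variable {p : ℕ} {A : Type*} [CommRing A]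

theorem map_aevalAeval_algHom {B B' : Type*} [CommRing B] [CommRing B'] [Algebra A B]
    [Algebra A B'] (φ : B →ₐ[A] B') (x y : B) (F : A[X][Y]) :
    φ (aevalAeval x y F) = aevalAeval (φ x) (φ y) F := by
  simpa [mapRingHom_id] using map_aevalAeval (RingHom.id A) φ.toRingHom (by simp) x y F

variable (𝒬 : A[X][Y]) (r : A[X])

theorem Dagger.mk_surjective : Function.Surjective (Dagger.mk p 𝒬 r) :=
  Ideal.Quotient.mkₐ_surjective A (daggerIdeal p 𝒬 r)

theorem Dagger.rInv_mul_aeval_x : Dagger.rInv p 𝒬 r * aeval (Dagger.x p 𝒬 r) r = 1 := by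
  have h : Dagger.mk p 𝒬 r (overconvergentSeries.var p A 1 *
      aeval (overconvergentSeries.var p A (0 : Fin 3)) r - 1) = 0 :=
    Ideal.Quotient.eq_zero_iff_mem.mpr (Ideal.subset_span (by simp))
  rw [map_sub, map_mul, map_one, ← aeval_algHom_apply, sub_eq_zero] at h
  exact h

theorem Dagger.aevalAeval_x_y : aevalAeval (Dagger.x p 𝒬 r) (Dagger.y p 𝒬 r) 𝒬 = 0 := by
  have h : Dagger.mk p 𝒬 r (aevalAeval (overconvergentSeries.var p A (0 : Fin 3))
      (overconvergentSeries.var p A 2) 𝒬) = 0 :=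
    Ideal.Quotient.eq_zero_iff_mem.mpr (Ideal.subset_span (by simp))
  rwa [map_aevalAeval_algHom] at h

theorem Dagger.solvesContractions [IsAdicComplete (Ideal.span {(p : A)}) A] :
    SolvesContractions p (Dagger p 𝒬 r) :=
  SolvesContractions.of_surjective (B := overconvergentSeries p (Fin 3) A)
    overconvergentSeries.exists_eq_add_mul_eval (Dagger.mk p 𝒬 r).toRingHom
    (Dagger.mk_surjective 𝒬 r)

/-- A semilinear ring homomorphism out of `ℛ†` is given by the images of `x`, `1/r` and `y`. -/
theorem Dagger.exists_ringHom [IsAdicComplete (Ideal.span {(p : A)}) A] (σ : A →+* A)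
    {x z y : Dagger p 𝒬 r} (hz : z * aeval x (r.map σ) = 1)
    (hy : aevalAeval x y (𝒬.map (mapRingHom σ)) = 0) :
    ∃ φ : Dagger p 𝒬 r →+* Dagger p 𝒬 r,
      (∀ a, φ (algebraMap A _ a) = algebraMap A _ (σ a)) ∧ φ (Dagger.x p 𝒬 r) = x ∧
      φ (Dagger.rInv p 𝒬 r) = z ∧ φ (Dagger.y p 𝒬 r) = y := by
  obtain ⟨x', rfl⟩ := Dagger.mk_surjective 𝒬 r x
  obtain ⟨y', rfl⟩ := Dagger.mk_surjective 𝒬 r y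
  obtain ⟨z', rfl⟩ := Dagger.mk_surjective 𝒬 r z
  obtain ⟨ψ, hψσ, hψ⟩ := overconvergentSeries.exists_substitution (p := p) σ ![x', z', y']
  have h0 := hψ 0
  have h1 := hψ 1
  have h2 := hψ 2
  simp only [Matrix.cons_val] at h0 h1 h2
  have hφσ : ∀ a, (Dagger.mk p 𝒬 r).toRingHom.comp ψ (algebraMap A _ a) =
      algebraMap A _ (σ a) := by
    intro a
    change Dagger.mk p 𝒬 r (ψ (algebraMap A _ a)) = _
    rw [hψσ, AlgHom.commutes]
  have hker : ∀ a ∈ daggerIdeal p 𝒬 r, (Dagger.mk p 𝒬 r).toRingHom.comp ψ a = 0 := by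
    intro a ha
    rw [← RingHom.mem_ker]
    refine (Ideal.span_le.mpr ?_ : daggerIdeal p 𝒬 r ≤ _) ha
    rintro _ (rfl | rfl)
    · change (Dagger.mk p 𝒬 r).toRingHom.comp ψ _ = 0
      rw [map_sub, map_mul, map_one, map_aeval_semilinear σ _ hφσ]
      change Dagger.mk p 𝒬 r (ψ _) * aeval (Dagger.mk p 𝒬 r (ψ _)) _ - 1 = 0
      rw [h1, h0, hz, sub_self]
    · change (Dagger.mk p 𝒬 r).toRingHom.comp ψ _ = 0
      rw [map_aevalAeval σ _ hφσ]
      change aevalAeval (Dagger.mk p 𝒬 r (ψ _)) (Dagger.mk p 𝒬 r (ψ _)) _ = 0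
      rw [h0, h2, hy]
  refine ⟨Ideal.Quotient.lift (daggerIdeal p 𝒬 r) _ hker, hφσ, ?_, ?_, ?_⟩
  · exact congr_arg (Dagger.mk p 𝒬 r) h0
  · exact congr_arg (Dagger.mk p 𝒬 r) h1
  · exact congr_arg (Dagger.mk p 𝒬 r) h2

/-- Modulo p every element of ℛ† is a polynomial in x, 1/r, y, and the congruence is stable under
sums and products. -/
theorem Dagger.isFrobeniusLift [Fact p.Prime] [IsDomain A] [CharZero A] {σ : A →+* A}
    (hσ : ∀ a, (p : A) ∣ σ a - a ^ p) {φ : Dagger p 𝒬 r →+* Dagger p 𝒬 r}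
    (hφ : ∀ a, φ (algebraMap A _ a) = algebraMap A _ (σ a))
    (hx : (p : Dagger p 𝒬 r) ∣ φ (Dagger.x p 𝒬 r) - Dagger.x p 𝒬 r ^ p)
    (hz : (p : Dagger p 𝒬 r) ∣ φ (Dagger.rInv p 𝒬 r) - Dagger.rInv p 𝒬 r ^ p)
    (hy : (p : Dagger p 𝒬 r) ∣ φ (Dagger.y p 𝒬 r) - Dagger.y p 𝒬 r ^ p) :
    IsFrobeniusLift p σ φ := by
  refine ⟨fun a b => by rw [Algebra.smul_def, Algebra.smul_def, map_mul, hφ], fun b => ?_⟩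
  rw [Ideal.mem_span_singleton]
  let S := frobeniusCongruence p φ (RingHom.id (Dagger p 𝒬 r))
  change b ∈ S
  obtain ⟨f, rfl⟩ := Dagger.mk_surjective 𝒬 r b
  have hp0 : p ≠ 0 := (Fact.out : p.Prime).ne_zero
  obtain ⟨P, h, rfl⟩ := overconvergentSeries.exists_eq_aeval_var_add
    (Nat.cast_ne_zero.mpr hp0) f
  rw [map_add]
  refine S.add_mem ?_ ?_
  · induction P using MvPolynomial.induction_on with
    | C a =>
      rw [MvPolynomial.aeval_C, AlgHom.commutes]
      change (p : Dagger p 𝒬 r) ∣ φ _ - (algebraMap A _ a) ^ p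
      rw [hφ, ← map_pow, ← map_sub]
      simpa using map_dvd (algebraMap A (Dagger p 𝒬 r)) (hσ a)
    | add P Q hP hQ =>
      rw [map_add, map_add]
      exact S.add_mem hP hQ
    | mul_X P i hP =>
      rw [map_mul, map_mul, MvPolynomial.aeval_X]
      refine S.mul_mem hP ?_
      fin_cases i
      · exact hx
      · exact hz
      · exact hy
  · change (p : Dagger p 𝒬 r) ∣ φ _ - (Dagger.mk p 𝒬 r _) ^ p
    rw [map_mul, map_mul, map_natCast, map_natCast, mul_pow]
    exact dvd_sub (dvd_mul_right _ _) ((dvd_pow_self _ hp0).mul_right _)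

/-- The Frobenius lift on `ℛ†` with `x ↦ x^p`, when `∂𝒬/∂y` is invertible. -/
theorem Dagger.exists_isFrobeniusLift [Fact p.Prime] [IsDomain A] [CharZero A]
    [IsAdicComplete (Ideal.span {(p : A)}) A] {σ : A →+* A} (hσ : ∀ a, (p : A) ∣ σ a - a ^ p)
    (hunit : IsUnit (aevalAeval (Dagger.x p 𝒬 r) (Dagger.y p 𝒬 r) (derivative 𝒬))) :
    ∃ φ : Dagger p 𝒬 r →+* Dagger p 𝒬 r, IsFrobeniusLift p σ φ ∧
      φ (Dagger.x p 𝒬 r) = Dagger.x p 𝒬 r ^ p := by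
  have hD := Dagger.solvesContractions (p := p) 𝒬 r
  have hp0 : p ≠ 0 := (Fact.out : p.Prime).ne_zero
  have hzr := Dagger.rInv_mul_aeval_x (p := p) 𝒬 r
  have hQ := Dagger.aevalAeval_x_y (p := p) 𝒬 r
  generalize hx : Dagger.x p 𝒬 r = x at *
  generalize hy : Dagger.y p 𝒬 r = y at *
  generalize hz : Dagger.rInv p 𝒬 r = z at *
  -- Since r^σ(x^p) ≡ r(x)^p modulo p, the element z^p inverts it modulo p.
  have hz1 : (p : Dagger p 𝒬 r) ∣ z ^ p * aeval (x ^ p) (r.map σ) - 1 := by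
    have := (dvd_aeval_sub_pow σ hσ x r).mul_left (z ^ p)
    rwa [mul_sub, ← mul_pow, hzr, one_pow] at this
  obtain ⟨Z, hZ⟩ := (hD.isUnit_of_dvd_mul_sub_one
    (mul_comm (z ^ p) (aeval (x ^ p) (r.map σ)) ▸ hz1)).exists_left_inv
  have hZz : (p : Dagger p 𝒬 r) ∣ Z - z ^ p := by
    have := dvd_neg.mpr (hz1.mul_left Z)
    convert this using 1
    linear_combination z ^ p * hZ
  obtain ⟨w, hw⟩ := hunit.exists_right_inv
  let F := (𝒬.map (mapRingHom σ)).map (aeval (x ^ p) : A[X] →ₐ[A] Dagger p 𝒬 r).toRingHom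
  have hF : ∀ t, F.eval t = aevalAeval (x ^ p) t (𝒬.map (mapRingHom σ)) := fun t =>
    (aevalAeval_eq_eval_map _ _ _).symm
  have hF' : ∀ t, F.derivative.eval t =
      aevalAeval (x ^ p) t ((derivative 𝒬).map (mapRingHom σ)) := fun t => by
    rw [aevalAeval_eq_eval_map, derivative_map, derivative_map]
  -- Modulo p, the values of F and F' at y^p are the p-th powers of 𝒬(x, y) = 0 and of the unit
  -- ∂𝒬/∂y.
  obtain ⟨T, hT, hTy⟩ := hD.exists_root F (y := y ^ p) (by
      rw [hF]
      simpa [hQ, hp0] using dvd_aevalAeval_sub_pow σ hσ x y 𝒬) (by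
      rw [hF']
      refine hD.isUnit_of_dvd_mul_sub_one (v := w ^ p) ?_
      have := (dvd_aevalAeval_sub_pow σ hσ x y (derivative 𝒬)).mul_right (w ^ p)
      rwa [sub_mul, ← mul_pow, hw, one_pow] at this)
  rw [hF] at hT
  obtain ⟨φ, hφσ, hφx, hφz, hφy⟩ := Dagger.exists_ringHom 𝒬 r σ hZ hT
  refine ⟨φ, Dagger.isFrobeniusLift 𝒬 r hσ hφσ ?_ ?_ ?_, hx ▸ hφx⟩
  · rw [hφx, hx, sub_self]
    exact dvd_zero _
  · rwa [hφz, hz]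
  · rwa [hφy, hy]

/-- The Newton iteration computes a Frobenius lift with `x ↦ x^p`. -/
theorem IsNewtonIteration.dvd_sub {σ : A →+* A} {s : A[X][Y]} {𝒬 : A[X][Y]} {r : A[X]}
    {φ : Dagger p 𝒬 r →+* Dagger p 𝒬 r} (hφ : IsFrobeniusLift p σ φ)
    (hφx : φ (Dagger.x p 𝒬 r) = Dagger.x p 𝒬 r ^ p) (hs : 𝒬 ∣ s * derivative 𝒬 - C r)
    {α β : ℕ → Dagger p 𝒬 r} (h : IsNewtonIteration p σ 𝒬 s r α β) (i : ℕ) :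
    (p : Dagger p 𝒬 r) ^ 2 ^ i ∣ φ (Dagger.rInv p 𝒬 r) - α i ∧
      (p : Dagger p 𝒬 r) ^ 2 ^ i ∣ φ (Dagger.y p 𝒬 r) - β i := by
  have hφσ : ∀ a, φ (algebraMap A _ a) = algebraMap A _ (σ a) := fun a => by
    rw [Algebra.algebraMap_eq_smul_one, hφ.semilinear, map_one, ← Algebra.algebraMap_eq_smul_one]
  have hzr := congr_arg φ (Dagger.rInv_mul_aeval_x (p := p) 𝒬 r)
  rw [map_mul, map_one, map_aeval_semilinear σ φ hφσ, hφx] at hzr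
  have hQ := congr_arg φ (Dagger.aevalAeval_x_y (p := p) 𝒬 r)
  rw [map_zero, map_aevalAeval σ φ hφσ, hφx] at hQ
  have hsQ : aevalAeval (Dagger.x p 𝒬 r ^ p) (φ (Dagger.y p 𝒬 r)) (s.map (mapRingHom σ)) *
      aevalAeval (Dagger.x p 𝒬 r ^ p) (φ (Dagger.y p 𝒬 r))
        ((derivative 𝒬).map (mapRingHom σ)) = aeval (Dagger.x p 𝒬 r ^ p) (r.map σ) := by
    obtain ⟨u, hu⟩ := hs
    have h1 : aevalAeval (Dagger.x p 𝒬 r) (Dagger.y p 𝒬 r) (s * derivative 𝒬) =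
        aeval (Dagger.x p 𝒬 r) r := by
      rw [eq_add_of_sub_eq hu, map_add, map_mul, Dagger.aevalAeval_x_y, zero_mul, zero_add,
        aevalAeval_C]
    have h2 := congr_arg φ h1
    rwa [map_aevalAeval σ φ hφσ, map_aeval_semilinear σ φ hφσ, hφx, Polynomial.map_mul,
      map_mul] at h2
  have hα := h.alpha_succ
  have hβ := h.beta_succ
  have hα0 : (p : Dagger p 𝒬 r) ∣ φ (Dagger.rInv p 𝒬 r) - α 0 := by
    rw [h.alpha_zero]
    exact Ideal.mem_span_singleton.mp (hφ.reduction _)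
  have hβ0 : (p : Dagger p 𝒬 r) ∣ φ (Dagger.y p 𝒬 r) - β 0 := by
    rw [h.beta_zero]
    exact Ideal.mem_span_singleton.mp (hφ.reduction _)
  clear h hφ hφσ hφx hs
  simp only [aevalAeval_eq_eval_map] at hQ hsQ hβ
  generalize φ (Dagger.rInv p 𝒬 r) = Z at *
  generalize φ (Dagger.y p 𝒬 r) = T at *
  rw [← derivative_map, ← derivative_map] at hsQ
  generalize map (aeval (Dagger.x p 𝒬 r ^ p)).toRingHom (map (mapRingHom σ) 𝒬) = F at *
  generalize map (aeval (Dagger.x p 𝒬 r ^ p)).toRingHom (map (mapRingHom σ) s) = G at *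
  generalize aeval (Dagger.x p 𝒬 r ^ p) (map σ r) = R at *
  induction i with
  | zero => simpa using ⟨hα0, hβ0⟩
  | succ i ih =>
    obtain ⟨⟨a, ha⟩, b, hb⟩ := ih
    obtain ⟨u, hu⟩ := hα i
    obtain ⟨v, hv⟩ := hβ i
    -- With errors q a and q b in α and β, the new α-error is q² R a². In β the linear term q b
    -- cancels because F'(T) G(T) Z = R Z = 1, so everything left is divisible by q².
    obtain ⟨e, he⟩ := F.binomExpansion T (β i - T)
    obtain ⟨g, hg⟩ := sub_dvd_eval_sub T (β i) G
    rw [add_sub_cancel, hQ, zero_add] at he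
    have hq : (p : Dagger p 𝒬 r) ^ 2 ^ (i + 1) = ((p : Dagger p 𝒬 r) ^ 2 ^ i) ^ 2 := by
      rw [pow_succ, pow_mul]
    rw [hq] at hu hv ⊢
    generalize (p : Dagger p 𝒬 r) ^ 2 ^ i = q at *
    have hA : α i = Z - q * a := by linear_combination -ha
    have hB : β i = T - q * b := by linear_combination -hb
    have hG : G.eval (β i) = G.eval T - q * b * g := by linear_combination -hg - g * hb
    have hAs := eq_add_of_sub_eq hu
    have hBs := eq_add_of_sub_eq hv
    rw [he, hG, hA, hB] at hBs
    rw [hA] at hAs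
    refine ⟨⟨R * a ^ 2 - u, ?_⟩, ⟨e * b ^ 2 * G.eval T * Z - (e * q * b ^ 2 -
      F.derivative.eval T * b) * (G.eval T * a + b * g * (Z - q * a)) - v, ?_⟩⟩
    · rw [hAs]
      linear_combination (Z - 2 * q * a) * hzr
    · rw [hBs]
      linear_combination -(q * b * Z) * hsQ - q * b * hzr

end dagger

/-! ### Witt vectors and invertibility of ∂𝒬/∂y. -/

section witt

variable {p : ℕ} [Fact p.Prime] {k : Type*} [Field k] [CharP k p] [PerfectRing k p]

theorem WittVector.dvd_iff_constantCoeff_eq_zero {a : WittVector p k} :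
    (p : WittVector p k) ∣ a ↔ WittVector.constantCoeff a = 0 := by
  rw [← RingHom.mem_ker, WittVector.ker_constantCoeff, Ideal.mem_span_singleton]

theorem WittVector.dvd_frobenius_sub_pow (a : WittVector p k) :
    (p : WittVector p k) ∣ WittVector.frobenius a - a ^ p := by
  rw [WittVector.dvd_iff_constantCoeff_eq_zero, map_sub, map_pow, sub_eq_zero]
  exact WittVector.coeff_frobenius_charP p a 0

instance WittVector.charZero : CharZero (WittVector p k) := by
  obtain ⟨q, hq⟩ := CharP.exists (WittVector p k)
  rcases CharP.char_is_prime_or_zero (WittVector p k) q with hprime | rfl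
  · have h0 : (q : k) = 0 := by
      rw [← map_natCast (WittVector.constantCoeff (p := p) (R := k)), CharP.cast_eq_zero, map_zero]
    have hpq := (Nat.prime_dvd_prime_iff_eq Fact.out hprime).mp ((CharP.cast_eq_zero_iff k p q).mp h0)
    exact absurd (hpq ▸ CharP.cast_eq_zero (WittVector p k) q) (WittVector.p_nonzero p k)
  · exact CharP.charP_to_charZero _

theorem isUnit_aevalAeval_derivative {Q : k[X][Y]} (hQ_irr : Irreducible Q) (hQ_monic : Q.Monic)
    (hQ_sep : (Q.map (algebraMap k[X] (RatFunc k))).Separable)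
    {𝒬 : (WittVector p k)[X][Y]} (h𝒬_monic : 𝒬.Monic)
    (h𝒬_lift : 𝒬.map (mapRingHom WittVector.constantCoeff) = Q)
    {r : (WittVector p k)[X]} (hr : IsSquarefreePart 𝒬.discr r) :
    IsUnit (aevalAeval (Dagger.x p 𝒬 r) (Dagger.y p 𝒬 r) (derivative 𝒬)) := by
  have hQdeg : 0 < Q.natDegree := by
    rw [Nat.pos_iff_ne_zero]
    intro h0
    exact hQ_irr.not_isUnit (eq_one_of_monic_natDegree_zero hQ_monic h0 ▸ isUnit_one)
  have hdeg : 0 < 𝒬.natDegree := by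
    rwa [← h𝒬_lift, h𝒬_monic.natDegree_map] at hQdeg
  have hQdiscr : Q.discr ≠ 0 := by
    intro h0
    refine discr_ne_zero_of_separable (hQ_monic.map (algebraMap k[X] (RatFunc k))) ?_ hQ_sep ?_
    · rwa [hQ_monic.natDegree_map]
    · rw [← map_discr_of_monic _ hQ_monic hQdeg, h0, map_zero]
  have hmap : 𝒬.discr.map WittVector.constantCoeff = Q.discr := by
    rw [← h𝒬_lift, ← map_discr_of_monic _ h𝒬_monic hdeg, coe_mapRingHom]
  -- A prime constant is an associate of p, so if it divided Δ then the reduction disc(Q) would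
  -- vanish, against separability.
  obtain ⟨n, hn⟩ := hr.exists_dvd_pow (fun h0 => hQdiscr (by rw [← hmap, h0, Polynomial.map_zero]))
    fun a ha hdvd => by
      have hpa : WittVector.constantCoeff a = 0 := by
        rw [← WittVector.dvd_iff_constantCoeff_eq_zero]
        exact ((IsDiscreteValuationRing.associated_of_irreducible _
          (WittVector.irreducible p (k := k)) ha.irreducible)).dvd
      have := Polynomial.map_dvd WittVector.constantCoeff hdvd
      rw [map_C, hpa, C_0, zero_dvd_iff, hmap] at this
      exact hQdiscr this
  have hru : IsUnit (aeval (Dagger.x p 𝒬 r) r) :=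
    IsUnit.of_mul_eq_one_right _ (Dagger.rInv_mul_aeval_x 𝒬 r)
  obtain ⟨a, b, hab⟩ := exists_mul_add_derivative_mul_eq_C_discr h𝒬_monic hdeg
  have h1 := congr_arg (aevalAeval (Dagger.x p 𝒬 r) (Dagger.y p 𝒬 r)) hab
  rw [map_add, map_mul, map_mul, Dagger.aevalAeval_x_y, zero_mul, zero_add, aevalAeval_C] at h1
  have h2 : IsUnit (aeval (Dagger.x p 𝒬 r) 𝒬.discr) := by
    refine isUnit_of_dvd_unit (map_dvd (aeval (Dagger.x p 𝒬 r)) hn) ?_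
    rw [map_pow]
    exact hru.pow n
  rw [← h1] at h2
  exact isUnit_of_mul_isUnit_left h2

end witt

end FrobLift

theorem mainTheorem5 (p : ℕ) [Fact p.Prime] (k : Type*) [Field k] [Finite k] [CharP k p]
    (Q : k[X][Y]) (hQ_irr : Irreducible Q) (hQ_monic : Q.Monic)
    (hQ_sep : (Q.map (algebraMap k[X] (RatFunc k))).Separable)
    (𝒬 : (WittVector p k)[X][Y]) (h𝒬_monic : 𝒬.Monic)
    (h𝒬_lift : 𝒬.map (mapRingHom WittVector.constantCoeff) = Q)
    (h𝒬_supp : ∀ i j : ℕ, (𝒬.coeff j).coeff i ≠ 0 ↔ (Q.coeff j).coeff i ≠ 0)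
    (r : (WittVector p k)[X]) (hr : FrobLift.IsSquarefreePart 𝒬.discr r) :
    ∃ φ : FrobLift.Dagger p 𝒬 r →+* FrobLift.Dagger p 𝒬 r,
      FrobLift.IsFrobeniusLift p (WittVector.frobenius : WittVector p k →+* WittVector p k) φ ∧
      φ (FrobLift.Dagger.x p 𝒬 r) = FrobLift.Dagger.x p 𝒬 r ^ p ∧
      ∀ s : (WittVector p k)[X][Y], 𝒬 ∣ s * derivative 𝒬 - C r →
        ∀ α β : ℕ → FrobLift.Dagger p 𝒬 r,
          FrobLift.IsNewtonIteration p WittVector.frobenius 𝒬 s r α β →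
          ∀ i : ℕ,
            (p : FrobLift.Dagger p 𝒬 r) ^ 2 ^ i ∣ φ (FrobLift.Dagger.rInv p 𝒬 r) - α i ∧
            (p : FrobLift.Dagger p 𝒬 r) ^ 2 ^ i ∣ φ (FrobLift.Dagger.y p 𝒬 r) - β i := by
  obtain ⟨φ, hφ, hφx⟩ := FrobLift.Dagger.exists_isFrobeniusLift 𝒬 r
    FrobLift.WittVector.dvd_frobenius_sub_pow
    (FrobLift.isUnit_aevalAeval_derivative hQ_irr hQ_monic hQ_sep h𝒬_monic h𝒬_lift hr)
  exact ⟨φ, hφ, hφx, fun s hs α β h i => h.dvd_sub hφ hφx hs i⟩
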